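/- Let $d\in\mathbb{N}$, let $\|\cdot\|$ be a norm on $\mathbb{R}^d$ with $|x^j|\le\|x\|$ for all $x$ and $j$, extended to $[-\infty,\infty]^d$ by $\|x\|=\infty$ if some coordinate of $x$ is infinite, and let $0<v<u<\infty$. For $w>0$ put $\mathbb{E}_w=\{x\in[-\infty,\infty]^d:\|x\|>w\}$ with the subspace topology, and let $\mathbf{M}_p([0,1]\times\mathbb{E}_v)$ be the space of Radon point measures on $[0,1]\times\mathbb{E}_v$, i.e. countable sums $\sum_i\delta_{(t_i,x_i)}$ that are finite on compact sets, with the vague topology. For such a measure define $$\psi^{(u)}\Big(\sum_i\delta_{(t_i,(x_i^1,\dots,x_i^d))}\Big)(t)=\Big(\sum_{t_i\le t}x_i^j\,1_{\{u<|x_i^j|<\infty\}}\Big)_{j=1,\dots,d},\qquad t\in[0,1].$$ Let $D([0,1],\mathbb{R}^d)$ be the space of càdlàg functions. The completed graph of $x\in D([0,1],\mathbb{R}^d)$ is $G_x=\{(t,z): z^j \text{ lies between } x^j(t-)\text{ and }x^j(t)\text{ for all }j\}$, where $x(0-)=x(0)$. It is ordered by: $(t_1,z_1)\le(t_2,z_2)$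 if $t_1<t_2$, or $t_1=t_2$ and $|x^j(t_1-)-z_1^j|\le|x^j(t_2-)-z_2^j|$ for all $j$. A weak parametric representation of $x$ is a continuous nondecreasing map $(r,w):[0,1]\to G_x$ with $r(0)=0$, $r(1)=1$, $w(1)=x(1)$. Let $d_w(x_1,x_2)$ be the infimum of $\sup_s|r_1(s)-r_2(s)|\vee\sup_s\|w_1(s)-w_2(s)\|$ over weak parametric representations $(r_i,w_i)$ of $x_i$. The weak $M_1$ topology is the topology in which a set is open if it contains, with each of its points $x$, a ball $\{y:d_w(y,x)<\varepsilon\}$, $\varepsilon>0$; thus $x_n\to x$ as soon as $d_w(x_n,x)\to0$. Let $\Lambda=\Lambda_1\cap\Lambda_2$, where $\Lambda_1$ is the set of $\eta\in\mathbf{M}_p([0,1]\times\mathbb{E}_v)$ with $$\eta(\{0,1\}\times\mathbb{E}_u)=0\quad\text{and}\quad\eta\big([0,1]\times\{x:|x^j|\in\{u,\infty\}\text{ for some }j\}\big)=0,$$ and $\Lambda_2$ is the set of $\eta$ such that for every $t\in[0,1]$, $\eta(\{t\}\times\prod_{j=1}^dA_j)=0$ for all except at most one of the sets $\prod_jA_j$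 with each $A_j$ equal to $(0,\infty]$ or $[-\infty,0)$. Then: (i) $\psi^{(u)}$ is well defined as a map $\mathbf{M}_p([0,1]\times\mathbb{E}_v)\to D([0,1],\mathbb{R}^d)$: the sums are finite sums, do not depend on how the measure is written as $\sum_i\delta_{(t_i,x_i)}$, and are càdlàg in $t$. (ii) Let $\eta\in\Lambda$ be such that for no $t\in[0,1]$ and $j\in\{1,\dots,d\}$ both $\eta(\{t\}\times\{x:x^j>u\})>0$ and $\eta(\{t\}\times\{x:x^j<-u\})>0$ (this holds automatically if $\eta$ has no atom $(t,x)$ for which some coordinate of $x$ is zero). Then $\psi^{(u)}$ is continuous at $\eta$ when $D([0,1],\mathbb{R}^d)$ carries the weak $M_1$ topology; moreover $d_w(\psi^{(u)}(\xi),\psi^{(u)}(\eta))\to0$ as $\xi\to\eta$ in $\mathbf{M}_p([0,1]\times\mathbb{E}_v)$. -/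

import Mathlib

open Set Filter Topology MeasureTheory
open scoped ENNReal NNReal unitInterval

noncomputable section

/-! ### The state space and Radon point measures -/

/-- A norm `N` on `ℝ^d`, extended to `[-∞,∞]^d` by the value `∞` at points with an infinite
coordinate. -/
def extNorm {d : ℕ} (N : Seminorm ℝ (Fin d → ℝ)) (x : Fin d → EReal) : ℝ≥0∞ :=
  open Classical in
  if ∀ j, (x j).abs < ⊤ then ENNReal.ofReal (N fun j => (x j).toReal) else ⊤

/-- `𝔼_v = {x ∈ [-∞,∞]^d : ‖x‖ > v}` with the subspace topology and Borel structure.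
For `v > 0` the origin is excluded automatically. -/
abbrev Exceed {d : ℕ} (N : Seminorm ℝ (Fin d → ℝ)) (v : ℝ) : Type :=
  {x : Fin d → EReal // ENNReal.ofReal v < extNorm N x}

/-- The time-space domain `[0,1] × 𝔼_v`. -/
abbrev TimeSpace {d : ℕ} (N : Seminorm ℝ (Fin d → ℝ)) (v : ℝ) : Type :=
  I × Exceed N v

/-- `η` is a point measure: a countable sum of unit point masses. -/
def IsPointMeasure {X : Type*} [MeasurableSpace X] (η : Measure X) : Prop :=
  ∃ (ι : Type) (_ : Countable ι) (p : ι → X), η = Measure.sum fun i => Measure.dirac (p i)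

/-- `𝐌_p([0,1] × 𝔼_v)`: point measures that are finite on compact sets. -/
def RadonPointMeasure {d : ℕ} (N : Seminorm ℝ (Fin d → ℝ)) (v : ℝ) : Type :=
  {η : Measure (TimeSpace N v) // IsPointMeasure η ∧ IsFiniteMeasureOnCompacts η}

/-- The vague topology: the coarsest topology making `η ↦ ∫ f dη` continuous for every
nonnegative continuous `f` with compact support. -/
instance {d : ℕ} (N : Seminorm ℝ (Fin d → ℝ)) (v : ℝ) :
    TopologicalSpace (RadonPointMeasure N v) :=
  TopologicalSpace.induced
    (fun η (f : CompactlySupportedContinuousMap (TimeSpace N v) ℝ≥0) => ∫ p, (f p : ℝ) ∂η.1)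
    inferInstance

/-! ### Càdlàg functions and the weak `M₁` topology -/

/-- Right-continuous on `[0,1)` with left limits on `(0,1]` (both conditions are void at the
excluded end point). -/
def IsCadlag {d : ℕ} (x : I → Fin d → ℝ) : Prop :=
  (∀ t, ContinuousWithinAt x (Ici t) t) ∧ ∀ t, ∃ l, Tendsto x (𝓝[<] t) (𝓝 l)

/-- `(t, z)` lies in the completed graph of `x`, that is, `z` is in the product segment
`[[x(t-), x(t)]]`. Here `Function.leftLim x 0 = x 0`. -/
def MemGraph {d : ℕ} (x : I → Fin d → ℝ) (t : I) (z : Fin d → ℝ) : Prop :=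
  ∀ j, z j ∈ uIcc (Function.leftLim x t j) (x t j)

/-- The order `(t₁, z₁) ≤ (t₂, z₂)` on the completed graph of `x`. -/
def GraphLE {d : ℕ} (x : I → Fin d → ℝ) (t₁ : I) (z₁ : Fin d → ℝ) (t₂ : I) (z₂ : Fin d → ℝ) :
    Prop :=
  t₁ < t₂ ∨ (t₁ = t₂ ∧
    ∀ j, |Function.leftLim x t₁ j - z₁ j| ≤ |Function.leftLim x t₂ j - z₂ j|)

/-- `(r, w)` is a weak parametric representation of the completed graph of `x`: a continuous
nondecreasing map of `[0,1]` into the graph with `r(0) = 0`, `r(1) = 1` and `w(1) = x(1)`. -/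
structure IsWeakParam {d : ℕ} (x : I → Fin d → ℝ) (r : C(I, I)) (w : C(I, Fin d → ℝ)) : Prop where
  mem_graph : ∀ s, MemGraph x (r s) (w s)
  mono : ∀ s s', s ≤ s' → GraphLE x (r s) (w s) (r s') (w s')
  time_zero : r 0 = 0
  time_one : r 1 = 1
  space_one : w 1 = x 1

/-- `d_w(x₁, x₂) = inf ‖r₁ - r₂‖ ∨ ‖w₁ - w₂‖` over weak parametric representations `(rᵢ, wᵢ)`
of `xᵢ`, with supremum norms over `[0,1]`. -/
def weakM1Dist {d : ℕ} (N : Seminorm ℝ (Fin d → ℝ)) (x₁ x₂ : I → Fin d → ℝ) : ℝ≥0∞ :=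
  ⨅ (r₁ : C(I, I)) (w₁ : C(I, Fin d → ℝ)) (_ : IsWeakParam x₁ r₁ w₁)
    (r₂ : C(I, I)) (w₂ : C(I, Fin d → ℝ)) (_ : IsWeakParam x₂ r₂ w₂),
    max (⨆ s : I, ENNReal.ofReal |(r₁ s : ℝ) - r₂ s|) (⨆ s : I, ENNReal.ofReal (N (w₁ s - w₂ s)))

/-- `D([0,1], ℝ^d)`. The norm `N` on `ℝ^d` is recorded because `d_w` refers to it. -/
structure SkorohodSpace {d : ℕ} (N : Seminorm ℝ (Fin d → ℝ)) : Type where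
  toFun : I → Fin d → ℝ
  cadlag : IsCadlag toFun

/-- The weak `M₁` topology: `U` is open when it contains a `d_w`-ball about each of its points. -/
instance {d : ℕ} (N : Seminorm ℝ (Fin d → ℝ)) : TopologicalSpace (SkorohodSpace N) where
  IsOpen U := ∀ x ∈ U, ∃ ε : ℝ≥0∞, 0 < ε ∧
    ∀ y : SkorohodSpace N, weakM1Dist N y.toFun x.toFun < ε → y ∈ U
  isOpen_univ := fun _ _ => ⟨1, one_pos, fun _ _ => mem_univ _⟩
  isOpen_inter := by
    rintro U V hU hV x ⟨hxU, hxV⟩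
    obtain ⟨a, ha, hU'⟩ := hU x hxU
    obtain ⟨b, hb, hV'⟩ := hV x hxV
    exact ⟨min a b, lt_min ha hb, fun y hy =>
      ⟨hU' y (hy.trans_le (min_le_left _ _)), hV' y (hy.trans_le (min_le_right _ _))⟩⟩
  isOpen_sUnion := by
    rintro S hS x ⟨U, hU, hx⟩
    obtain ⟨a, ha, hU'⟩ := hS U hU x hx
    exact ⟨a, ha, fun y hy => ⟨U, hU, hU' y hy⟩⟩

/-! ### The summation functional and the set of continuity points -/

/-- The condition `u < |y| < ∞` on an extended real `y`. -/
def ExceedsFinite (u : ℝ) (y : EReal) : Prop :=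
  ENNReal.ofReal u < y.abs ∧ y.abs < ⊤

/-- The summation functional. Its `j`-th coordinate at time `t` is the sum of `x^j` over the points
`(s, x)` of `η`, counted with multiplicity, with `s ≤ t` and `u < |x^j| < ∞`; the sum is written
as an integral with respect to `η`. -/
def summation {d : ℕ} {N : Seminorm ℝ (Fin d → ℝ)} {v : ℝ} (u : ℝ) (η : RadonPointMeasure N v) :
    I → Fin d → ℝ :=
  fun t j => ∫ p in {p : TimeSpace N v | p.1 ≤ t ∧ ExceedsFinite u (p.2.1 j)},
    (p.2.1 j).toReal ∂η.1

/-- `η({0,1} × 𝔼_u) = 0` and `η([0,1] × {x : |x^j| ∈ {u, ∞} for some j}) = 0`. -/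
def Lambda₁ {d : ℕ} (N : Seminorm ℝ (Fin d → ℝ)) (v u : ℝ) : Set (RadonPointMeasure N v) :=
  {η | η.1 {p | (p.1 = 0 ∨ p.1 = 1) ∧ ENNReal.ofReal u < extNorm N p.2.1} = 0 ∧
    η.1 {p | ∃ j, (p.2.1 j).abs = ENNReal.ofReal u ∨ (p.2.1 j).abs = ⊤} = 0}

/-- The open orthant `∏ A_j`, where `A_j = (0,∞]` if `s j` is true and `A_j = [-∞,0)` otherwise. -/
def orthant {d : ℕ} (s : Fin d → Bool) : Set (Fin d → EReal) :=
  {x | ∀ j, if s j = true then 0 < x j else x j < 0}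

/-- For every `t`, `η({t} × ∏ A_j) = 0` for all except at most one orthant `∏ A_j`. -/
def Lambda₂ {d : ℕ} (N : Seminorm ℝ (Fin d → ℝ)) (v : ℝ) : Set (RadonPointMeasure N v) :=
  {η | ∀ t : I, {s : Fin d → Bool | η.1 {p | p.1 = t ∧ p.2.1 ∈ orthant s} ≠ 0}.Subsingleton}

/-- For no time `t` and coordinate `j` does `η` charge both `{t} × {x^j > u}` and
`{t} × {x^j < -u}`. -/
def NoOppositeSigns {d : ℕ} {N : Seminorm ℝ (Fin d → ℝ)} {v : ℝ} (u : ℝ)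
    (η : RadonPointMeasure N v) : Prop :=
  ∀ (t : I) (j : Fin d), η.1 {p | p.1 = t ∧ ((u : ℝ) : EReal) < p.2.1 j} = 0 ∨
    η.1 {p | p.1 = t ∧ p.2.1 j < ((-u : ℝ) : EReal)} = 0

end

/-! # Continuity of the truncated summation functional in the weak `M₁` topology

Only the points with a coordinate of modulus at least `u` (`largePoints`) contribute to the
functional. They form a compact set, because `|x j| ≤ ‖x‖` and `v < u`; hence there are finitely
many of them, and the functional is a step function (`summation_eq_stepFun`), in particular càdlàg.

Let `η` be a measure as in the continuity claim. By `Lambda₁` its large points lie in the interior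
of `largePoints`, so the portmanteau theorem for integer-valued measures puts the large points of
any vaguely close `ξ` in bijection with those of `η`, with matched points close to each other
(`eventually_exists_matching`). Closeness preserves the strict order of the jump times and creates
no new signs of truncated coordinates; so for `ξ` as for `η` simultaneous jumps have no coordinates
of opposite sign.

It remains to compare two step functions `∑ i, 1_{τ i ≤ t} c i` with matched jumps. List the jumps
in an order that is nondecreasing for the times of both functions. Both get a parametric
representation `(r, ∑ i, ρ i • c i)`, in which the clock `r` stops at each `τ i` while the switch
`ρ i` moves from `0` to `1`; the switches are the same for both functions. When several
jumps occur at the same time, the switches are moved one after the other, which still describes a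
path in the completed graph, nondecreasing in its order, because every coordinate moves in one
direction only (`isWeakParam_stepFun`): this is where the weak version of the `M₁` order and the
sign condition are needed. The two representations differ by at most a multiple of the differences
of the times and of the jumps (`weakM1Dist_stepFun_le`). -/

/-! ### Vague convergence of point measures -/

section Vague

variable {X : Type*} [MeasurableSpace X]

lemma sum_dirac_apply {ι : Type*} (p : ι → X) {A : Set X} (hA : MeasurableSet A) :
    Measure.sum (fun i => Measure.dirac (p i)) A = ((p ⁻¹' A).encard : ℝ≥0∞) := by
  rw [Measure.sum_apply _ hA, ← ENNReal.tsum_set_one,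
    tsum_subtype (p ⁻¹' A) (fun _ => (1 : ℝ≥0∞))]
  refine tsum_congr fun i => ?_
  rw [Measure.dirac_apply' _ hA]
  rfl

lemma notMem_of_sum_dirac_eq_zero {ι : Type*} {p : ι → X} {η : Measure X}
    (hp : η = Measure.sum fun i => Measure.dirac (p i)) {A : Set X} (hA : η A = 0) (i : ι) :
    p i ∉ A := by
  intro hi
  have h1 : (1 : ℝ≥0∞) ≤ Measure.dirac (p i) A := by
    simp [hi]
  have h2 : Measure.dirac (p i) A ≤ η A := by
    rw [hp]
    exact Measure.le_iff'.1 (Measure.le_sum _ i) A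
  simp [hA] at h2
  simp [h2] at h1

lemma setIntegral_sum_dirac [MeasurableSingletonClass X] {ι : Type*} (p : ι → X) {A : Set X}
    (hA : MeasurableSet A) (hfin : (p ⁻¹' A).Finite) (g : X → ℝ) :
    ∫ x in A, g x ∂Measure.sum (fun i => Measure.dirac (p i)) = ∑ i ∈ hfin.toFinset, g (p i) := by
  have hsum : (Measure.sum fun i => Measure.dirac (p i)).restrict A =
      ∑ i ∈ hfin.toFinset, Measure.dirac (p i) := by
    classical
    ext B hB
    rw [Measure.restrict_sum _ hA, Measure.sum_apply _ hB, Measure.finsetSum_apply,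
      tsum_eq_sum (s := hfin.toFinset)]
    · refine Finset.sum_congr rfl fun i hi => ?_
      have hi' : p i ∈ A := by simpa using hi
      rw [restrict_dirac, if_pos hi']
    · intro i hi
      have hi' : p i ∉ A := by simpa using hi
      rw [restrict_dirac, if_neg hi']
      rfl
  rw [hsum, integral_finsetSum_measure fun i _ => integrable_dirac (by simp)]
  exact Finset.sum_congr rfl fun i _ => integral_dirac _ _

variable [TopologicalSpace X] [T2Space X] [BorelSpace X]

lemma finite_preimage_of_isCompact {ι : Type*} {p : ι → X} {η : Measure X}
    [IsFiniteMeasureOnCompacts η] (hp : η = Measure.sum fun i => Measure.dirac (p i)) {C : Set X}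
    (hC : IsCompact C) : (p ⁻¹' C).Finite := by
  rw [← Set.encard_ne_top_iff]
  intro h
  have hlt := hC.measure_lt_top (μ := η)
  rw [hp, sum_dirac_apply p hC.measurableSet, h] at hlt
  simp at hlt

variable [LocallyCompactSpace X]

/-- Urysohn's lemma in integrated form: a test function squeezed between the indicators of `K`
and `V` has integral between `μ K` and `μ V`, for every measure `μ` finite on compact sets. -/
lemma exists_testFunction {K V : Set X} (hK : IsCompact K) (hV : IsOpen V) (hKV : K ⊆ V) :
    ∃ f : CompactlySupportedContinuousMap X ℝ≥0, ∀ μ : Measure X, IsFiniteMeasureOnCompacts μ →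
      μ K ≤ ENNReal.ofReal (∫ x, (f x : ℝ) ∂μ) ∧ ENNReal.ofReal (∫ x, (f x : ℝ) ∂μ) ≤ μ V := by
  obtain ⟨g, hg1, hgc, hgV, hg01⟩ := exists_continuousMap_one_of_isCompact_subset_isOpen hK hV hKV
  let f : CompactlySupportedContinuousMap X ℝ≥0 :=
    ⟨⟨fun x => (g x).toNNReal, by fun_prop⟩, by
      have : HasCompactSupport g := hgc
      exact this.comp_left (g := Real.toNNReal) (by simp)⟩
  have hf : ∀ x, (f x : ℝ) = g x := fun x => Real.coe_toNNReal _ (hg01 x).1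
  refine ⟨f, fun μ hμ => ?_⟩
  have hint : Integrable g μ := g.continuous.integrable_of_hasCompactSupport hgc
  simp only [hf]
  rw [ofReal_integral_eq_lintegral_ofReal hint (ae_of_all _ fun x => (hg01 x).1)]
  constructor
  · rw [← lintegral_indicator_one hK.measurableSet]
    refine lintegral_mono fun x => ?_
    by_cases hx : x ∈ K
    · simp [hx, hg1 hx]
    · simp [hx]
  · rw [← lintegral_indicator_one hV.measurableSet]
    refine lintegral_mono fun x => ?_
    by_cases hx : x ∈ V
    · simp [hx, (hg01 x).2]
    · have : g x = 0 := image_eq_zero_of_notMem_tsupport fun h => hx (hgV h)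
      simp [this]

variable {Ω : Type*} {l : Filter Ω} {F : Ω → Measure X} {η : Measure X}
  {ι : Type*} {p : ι → X}

/-- Portmanteau theorem, open sets: points of a compact `K ⊆ V` stay in the open set `V`. -/
lemma eventually_le_encard_preimage (hF : ∀ ω, IsFiniteMeasureOnCompacts (F ω))
    [IsFiniteMeasureOnCompacts η]
    (hlim : ∀ f : CompactlySupportedContinuousMap X ℝ≥0,
      Tendsto (fun ω => ∫ x, (f x : ℝ) ∂F ω) l (𝓝 (∫ x, (f x : ℝ) ∂η)))
    (hp : η = Measure.sum fun i => Measure.dirac (p i)) {K V : Set X} (hK : IsCompact K)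
    (hV : IsOpen V) (hKV : K ⊆ V) :
    ∀ᶠ ω in l, ∀ (κ : Type) (q : κ → X), F ω = Measure.sum (fun k => Measure.dirac (q k)) →
      (p ⁻¹' K).encard ≤ (q ⁻¹' V).encard := by
  have hηK : η K = ((p ⁻¹' K).encard : ℝ≥0∞) := by
    conv_lhs => rw [hp]
    exact sum_dirac_apply p hK.measurableSet
  have hfin : (p ⁻¹' K).encard ≠ ⊤ :=
    Set.encard_ne_top_iff.2 (finite_preimage_of_isCompact hp hK)
  obtain ⟨n, hn⟩ := ENat.ne_top_iff_exists.1 hfin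
  rw [← hn] at hηK ⊢
  obtain _ | n := n
  · simp
  have hlt : (n : ℝ≥0∞) < η K := by
    rw [hηK]
    exact_mod_cast Nat.lt_succ_self n
  obtain ⟨f, hf⟩ := exists_testFunction hK hV hKV
  have ht := (ENNReal.continuous_ofReal.tendsto _).comp (hlim f)
  filter_upwards [ht.eventually_const_lt (hlt.trans_le (hf η inferInstance).1)] with ω hω κ q hq
  have h1 : (n : ℝ≥0∞) < F ω V := hω.trans_le (hf _ (hF ω)).2
  rw [hq, sum_dirac_apply q hV.measurableSet] at h1
  have h2 : (n : ℕ∞) < (q ⁻¹' V).encard := by exact_mod_cast h1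
  exact_mod_cast Order.add_one_le_of_lt h2

variable [SecondCountableTopology X]

/-- Portmanteau theorem, compact sets: no points enter a compact set in the vague limit. -/
lemma eventually_encard_preimage_le (hF : ∀ ω, IsFiniteMeasureOnCompacts (F ω))
    [IsFiniteMeasureOnCompacts η]
    (hlim : ∀ f : CompactlySupportedContinuousMap X ℝ≥0,
      Tendsto (fun ω => ∫ x, (f x : ℝ) ∂F ω) l (𝓝 (∫ x, (f x : ℝ) ∂η)))
    (hp : η = Measure.sum fun i => Measure.dirac (p i)) {C : Set X} (hC : IsCompact C) :
    ∀ᶠ ω in l, ∀ (κ : Type) (q : κ → X), F ω = Measure.sum (fun k => Measure.dirac (q k)) →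
      (q ⁻¹' C).encard ≤ (p ⁻¹' C).encard := by
  have hηC : η C = ((p ⁻¹' C).encard : ℝ≥0∞) := by
    conv_lhs => rw [hp]
    exact sum_dirac_apply p hC.measurableSet
  have hfin : (p ⁻¹' C).encard ≠ ⊤ :=
    Set.encard_ne_top_iff.2 (finite_preimage_of_isCompact hp hC)
  obtain ⟨n, hn⟩ := ENat.ne_top_iff_exists.1 hfin
  rw [← hn] at hηC ⊢
  have hlt : η C < ((n + 1 : ℕ) : ℝ≥0∞) := by
    rw [hηC]
    exact_mod_cast Nat.lt_succ_self n
  obtain ⟨W, hCW, hW, hWlt⟩ := Set.exists_isOpen_lt_of_lt C _ hlt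
  obtain ⟨f, hf⟩ := exists_testFunction hC hW hCW
  have ht := (ENNReal.continuous_ofReal.tendsto _).comp (hlim f)
  filter_upwards [ht.eventually_lt_const ((hf η inferInstance).2.trans_lt hWlt)] with ω hω κ q hq
  have h1 : F ω C < ((n + 1 : ℕ) : ℝ≥0∞) := (hf _ (hF ω)).1.trans_lt hω
  rw [hq, sum_dirac_apply q hC.measurableSet] at h1
  have h2 : (q ⁻¹' C).encard < ((n + 1 : ℕ) : ℕ∞) := by exact_mod_cast h1
  exact ENat.lt_natCast_add_one_iff.1 (by exact_mod_cast h2)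

/-- Vague convergence of point measures as convergence of points: if `C` is compact and the
points of `η` in `C` all lie in the interior of `C`, then the points in `C` of a measure vaguely
close to `η` correspond bijectively to those of `η`, and the tuple they form is close to the
tuple of the points of `η`. -/
theorem eventually_exists_matching (hF : ∀ ω, IsFiniteMeasureOnCompacts (F ω))
    [IsFiniteMeasureOnCompacts η]
    (hlim : ∀ f : CompactlySupportedContinuousMap X ℝ≥0,
      Tendsto (fun ω => ∫ x, (f x : ℝ) ∂F ω) l (𝓝 (∫ x, (f x : ℝ) ∂η)))
    (hp : η = Measure.sum fun i => Measure.dirac (p i)) {C : Set X} (hC : IsCompact C)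
    (hCint : ∀ i, p i ∈ C → p i ∈ interior C) {P : ({i // p i ∈ C} → X) → Prop}
    (hP : ∀ᶠ z in 𝓝 (fun i : {i // p i ∈ C} => p i), P z) :
    ∀ᶠ ω in l, ∀ (κ : Type) (q : κ → X), F ω = Measure.sum (fun k => Measure.dirac (q k)) →
      ∃ e : {i // p i ∈ C} ≃ {k // q k ∈ C}, P fun i => q (e i) := by
  have hSfin : (p ⁻¹' C).Finite := finite_preimage_of_isCompact hp hC
  have : Finite {i // p i ∈ C} := hSfin
  rw [nhds_pi, Filter.Eventually, Filter.mem_pi] at hP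
  obtain ⟨J, -, T, hT, hTP⟩ := hP
  obtain ⟨U, hU, hUdisj⟩ := (hSfin.image p).t2_separation
  -- Pairwise disjoint neighbourhoods of the limit points, inside `C` and small enough for `P`.
  let V : X → Set X := fun x =>
    interior (U x ∩ interior C ∩ ⋂ i : {i // p i ∈ C}, ⋂ _ : p i = x, T i)
  have hVmem : ∀ i (hi : p i ∈ C), p i ∈ V (p i) := by
    intro i hi
    rw [mem_interior_iff_mem_nhds]
    refine inter_mem (inter_mem ((hU _).2.mem_nhds (hU _).1)
      (isOpen_interior.mem_nhds (hCint i hi))) ?_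
    refine Filter.iInter_mem.2 fun k => Filter.iInter_mem.2 fun hk => ?_
    rw [← hk]
    exact hT k
  have hVU : ∀ x, V x ⊆ U x := fun x y hy => (interior_subset hy).1.1
  have hVC : ∀ x, V x ⊆ C := fun x y hy => interior_subset (interior_subset hy).1.2
  have hVT : ∀ (i : {i // p i ∈ C}) {y}, y ∈ V (p i) → y ∈ T i := fun i y hy =>
    mem_iInter.1 (mem_iInter.1 (interior_subset hy).2 i) rfl
  have hlow : ∀ᶠ ω in l, ∀ x ∈ p '' (p ⁻¹' C), ∀ (κ : Type) (q : κ → X),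
      F ω = Measure.sum (fun k => Measure.dirac (q k)) →
      (p ⁻¹' {x}).encard ≤ (q ⁻¹' V x).encard := by
    rw [Filter.eventually_all_finite (hSfin.image p)]
    rintro _ ⟨i, hi, rfl⟩
    exact eventually_le_encard_preimage hF hlim hp isCompact_singleton isOpen_interior
      (singleton_subset_iff.2 (hVmem i hi))
  filter_upwards [hlow, eventually_encard_preimage_le hF hlim hp hC] with ω hω1 hω2 κ q hq
  replace hω1 : ∀ x ∈ p '' (p ⁻¹' C), (p ⁻¹' {x}).encard ≤ (q ⁻¹' V x).encard :=
    fun x hx => hω1 x hx κ q hq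
  replace hω2 := hω2 κ q hq
  have hS'fin : (q ⁻¹' C).Finite :=
    Set.finite_of_encard_le_coe (k := (p ⁻¹' C).ncard) (by rwa [hSfin.cast_ncard_eq])
  have : Finite {k // q k ∈ C} := hS'fin
  have hg : ∀ x ∈ p '' (p ⁻¹' C), ∃ g : ι → κ, p ⁻¹' {x} ⊆ g ⁻¹' (q ⁻¹' V x) ∧
      InjOn g (p ⁻¹' {x}) := by
    rintro _ ⟨i, hi, rfl⟩
    have hle := hω1 (p i) ⟨i, hi, rfl⟩
    have hne : (q ⁻¹' V (p i)).Nonempty := by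
      rw [← Set.one_le_encard_iff_nonempty]
      exact (Set.one_le_encard_iff_nonempty (s := p ⁻¹' {p i}).2 ⟨i, mem_singleton _⟩).trans hle
    have : Nonempty κ := ⟨hne.some⟩
    refine Set.Finite.exists_injOn_of_encard_le (hSfin.subset ?_) hle
    intro k hk
    rw [mem_preimage, mem_singleton_iff] at hk
    rwa [mem_preimage, hk]
  choose g hgV hginj using hg
  let G : {i // p i ∈ C} → κ := fun i => g (p i) ⟨i, i.2, rfl⟩ i
  have hgi : ∀ i : {i // p i ∈ C}, q (G i) ∈ V (p i.1) := fun i =>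
    hgV (p i) ⟨i, i.2, rfl⟩ (mem_singleton (p i))
  let e : {i // p i ∈ C} → {k // q k ∈ C} := fun i => ⟨G i, hVC _ (hgi i)⟩
  have he : Function.Injective e := by
    intro i k hik
    have h1 : G i = G k := congrArg Subtype.val hik
    have hpx : p i = p k := by
      by_contra hne
      refine (Set.disjoint_left.1 (hUdisj ⟨i, i.2, rfl⟩ ⟨k, k.2, rfl⟩ hne)) (hVU _ (hgi i)) ?_
      rw [h1]
      exact hVU _ (hgi k)
    -- The injection `g x` depends on a proof that `x` lies in `p '' (p ⁻¹' C)`, hence the transport.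
    have hcongr : ∀ {x y} (hx : x ∈ p '' (p ⁻¹' C)) (hy : y ∈ p '' (p ⁻¹' C)), x = y →
        g x hx = g y hy := by
      rintro x _ hx hy rfl
      rfl
    refine Subtype.ext (hginj (p k) ⟨k, k.2, rfl⟩ hpx (mem_singleton _) ?_)
    exact (congrFun (hcongr _ ⟨i, i.2, rfl⟩ hpx.symm) _).trans h1
  have hcard : Nat.card {k // q k ∈ C} ≤ Nat.card {i // p i ∈ C} := by
    have : (q ⁻¹' C).ncard ≤ (p ⁻¹' C).ncard := by
      rwa [← hSfin.cast_ncard_eq, ← hS'fin.cast_ncard_eq, Nat.cast_le] at hω2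
    exact this
  exact ⟨Equiv.ofBijective e (he.bijective_of_nat_card_le hcard), hTP fun i _ => hVT i (hgi i)⟩

end Vague

/-! ### Step functions -/

section Step

variable {d : ℕ} {ι : Type*} [Fintype ι]

/-- The step function on `[0,1]` that starts at `0` and has the jump `c i` at time `τ i`. -/
noncomputable def stepFun (τ : ι → I) (c : ι → Fin d → ℝ) : I → Fin d → ℝ :=
  fun t => ∑ i, if τ i ≤ t then c i else 0

lemma stepFun_eventuallyEq_right (τ : ι → I) (c : ι → Fin d → ℝ) (t : I) :
    ∀ᶠ s in 𝓝[≥] t, stepFun τ c s = stepFun τ c t := by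
  have h : ∀ i, ∀ᶠ s in 𝓝[≥] t, (τ i ≤ s ↔ τ i ≤ t) := by
    intro i
    by_cases hi : τ i ≤ t
    · filter_upwards [self_mem_nhdsWithin] with s hs
      simp [hi, hi.trans hs]
    · filter_upwards [mem_nhdsWithin_of_mem_nhds (Iio_mem_nhds (not_le.1 hi))] with s hs
      simp [hi, not_le.2 (mem_Iio.1 hs)]
  filter_upwards [eventually_all.2 h] with s hs
  simp [stepFun, hs]

lemma stepFun_eventuallyEq_left (τ : ι → I) (c : ι → Fin d → ℝ) (t : I) :
    ∀ᶠ s in 𝓝[<] t, stepFun τ c s = ∑ i, if τ i < t then c i else 0 := by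
  have h : ∀ i, ∀ᶠ s in 𝓝[<] t, (τ i ≤ s ↔ τ i < t) := by
    intro i
    by_cases hi : τ i < t
    · filter_upwards [mem_nhdsWithin_of_mem_nhds (Ioi_mem_nhds hi)] with s hs
      simp [hi, (mem_Ioi.1 hs).le]
    · filter_upwards [self_mem_nhdsWithin] with s hs
      simp [hi, not_le.2 (lt_of_lt_of_le hs (not_lt.1 hi))]
  filter_upwards [eventually_all.2 h] with s hs
  simp [stepFun, hs]

lemma isCadlag_stepFun (τ : ι → I) (c : ι → Fin d → ℝ) : IsCadlag (stepFun τ c) :=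
  ⟨fun t => tendsto_const_nhds.congr'
      ((stepFun_eventuallyEq_right τ c t).mono fun _ h => h.symm),
    fun t => ⟨_, tendsto_const_nhds.congr'
      ((stepFun_eventuallyEq_left τ c t).mono fun _ h => h.symm)⟩⟩

lemma leftLim_stepFun {τ : ι → I} (hτ : ∀ i, 0 < τ i) (c : ι → Fin d → ℝ) (t : I) :
    Function.leftLim (stepFun τ c) t = ∑ i, if τ i < t then c i else 0 := by
  rcases eq_or_lt_of_le (unitInterval.nonneg' (t := t)) with rfl | ht
  · have hbot : 𝓝[<] (0 : I) = ⊥ := by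
      have : Iio (0 : I) = ∅ := eq_empty_of_forall_notMem fun s hs =>
        not_lt.2 (unitInterval.nonneg' (t := s)) hs
      simp [this]
    rw [leftLim_eq_of_eq_bot _ hbot]
    refine Finset.sum_congr rfl fun i _ => ?_
    simp [(hτ i).not_ge, (hτ i).not_gt]
  · have : (𝓝[<] t).NeBot := nhdsLT_neBot_of_exists_lt ⟨0, ht⟩
    exact leftLim_eq_of_tendsto (tendsto_const_nhds.congr'
      ((stepFun_eventuallyEq_left τ c t).mono fun _ h => h.symm))

/-- A clock `r` together with switches `ρ i`, where the `i`-th switch is turned from `0` to `1`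
while the clock shows `τ i`, yields the weak parametric representation `(r, ∑ ρ i • c i)` of the
step function, provided that simultaneous jumps have no coordinates of opposite sign. The switches
of simultaneous jumps need not be turned simultaneously: the product segment allows any
coordinatewise monotone path. -/
lemma isWeakParam_stepFun {τ : ι → I} {c : ι → Fin d → ℝ} (hτ0 : ∀ i, 0 < τ i)
    (hτ1 : ∀ i, τ i < 1) (hsign : ∀ i k j, τ i = τ k → 0 < c i j → 0 ≤ c k j)
    {r : C(I, I)} {w : C(I, Fin d → ℝ)} {ρ : ι → I → ℝ}
    (hwρ : ∀ s, w s = ∑ i, ρ i s • c i) (hr : Monotone r) (hr0 : r 0 = 0) (hr1 : r 1 = 1)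
    (hρ : ∀ i, Monotone (ρ i)) (hρ01 : ∀ i s, ρ i s ∈ Icc (0 : ℝ) 1)
    (hlt : ∀ i s, r s < τ i → ρ i s = 0) (hgt : ∀ i s, τ i < r s → ρ i s = 1) :
    IsWeakParam (stepFun τ c) r w := by
  have hleft : ∀ t j, Function.leftLim (stepFun τ c) t j = ∑ i, if τ i < t then c i j else 0 := by
    intro t j
    rw [leftLim_stepFun hτ0, Finset.sum_apply]
    exact Finset.sum_congr rfl fun i _ => by split_ifs <;> rfl
  have hval : ∀ t j, stepFun τ c t j = Function.leftLim (stepFun τ c) t j +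
      ∑ i, if τ i = t then c i j else 0 := by
    intro t j
    rw [hleft, ← Finset.sum_add_distrib, stepFun, Finset.sum_apply]
    refine Finset.sum_congr rfl fun i _ => ?_
    rcases lt_trichotomy (τ i) t with h | h | h
    · simp [h, h.le, h.ne]
    · simp [h]
    · simp [h.not_gt, h.not_ge, h.ne']
  have hw : ∀ s j, w s j = Function.leftLim (stepFun τ c) (r s) j +
      ∑ i, if τ i = r s then ρ i s * c i j else 0 := by
    intro s j
    rw [hwρ, hleft, ← Finset.sum_add_distrib, Finset.sum_apply]
    refine Finset.sum_congr rfl fun i _ => ?_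
    rcases lt_trichotomy (τ i) (r s) with h | h | h
    · simp [h, h.ne, hgt i s h]
    · simp [h]
    · simp [h.not_gt, h.ne', hlt i s h]
  have hdich : ∀ t j, (∀ i, τ i = t → 0 ≤ c i j) ∨ (∀ i, τ i = t → c i j ≤ 0) := by
    intro t j
    by_cases h : ∃ i, τ i = t ∧ 0 < c i j
    · obtain ⟨i, hi, hpos⟩ := h
      exact Or.inl fun k hk => hsign i k j (hi.trans hk.symm) hpos
    · push Not at h
      exact Or.inr h
  constructor
  · intro s j
    rw [hw s j, hval, mem_uIcc]
    rcases hdich (r s) j with h | h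
    · left
      refine ⟨le_add_of_nonneg_right (Finset.sum_nonneg fun i _ => ?_),
        add_le_add_right (Finset.sum_le_sum fun i _ => ?_) _⟩
      · split_ifs with hi
        · exact mul_nonneg (hρ01 i s).1 (h i hi)
        · rfl
      · split_ifs with hi
        · exact mul_le_of_le_one_left (h i hi) (hρ01 i s).2
        · rfl
    · right
      refine ⟨add_le_add_right (Finset.sum_le_sum fun i _ => ?_) _,
        add_le_of_nonpos_right (Finset.sum_nonpos fun i _ => ?_)⟩
      · split_ifs with hi
        · nlinarith [h i hi, (hρ01 i s).2]
        · rfl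
      · split_ifs with hi
        · exact mul_nonpos_of_nonneg_of_nonpos (hρ01 i s).1 (h i hi)
        · rfl
  · intro s s' hss
    rcases (hr hss).lt_or_eq with h | h
    · exact Or.inl h
    refine Or.inr ⟨h, fun j => ?_⟩
    rw [hw s j, hw s' j, ← h, sub_add_cancel_left, sub_add_cancel_left, abs_neg, abs_neg]
    rcases hdich (r s) j with h' | h'
    · refine abs_le_abs_of_nonneg (Finset.sum_nonneg fun i _ => ?_)
        (Finset.sum_le_sum fun i _ => ?_)
      · split_ifs with hi
        · exact mul_nonneg (hρ01 i s).1 (h' i hi)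
        · rfl
      · split_ifs with hi
        · exact mul_le_mul_of_nonneg_right (hρ i hss) (h' i hi)
        · rfl
    · refine abs_le_abs_of_nonpos (Finset.sum_nonpos fun i _ => ?_)
        (Finset.sum_le_sum fun i _ => ?_)
      · split_ifs with hi
        · exact mul_nonpos_of_nonneg_of_nonpos (hρ01 i s).1 (h' i hi)
        · rfl
      · split_ifs with hi
        · exact mul_le_mul_of_nonpos_right (hρ i hss) (h' i hi)
        · rfl
  · exact hr0
  · exact hr1
  · ext j
    rw [hwρ, Finset.sum_apply, stepFun, Finset.sum_apply]
    refine Finset.sum_congr rfl fun i _ => ?_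
    simp [hgt i 1 (by rw [hr1]; exact hτ1 i), (hτ1 i).le]

end Step

/-! ### Clocks that stop at prescribed times -/

section Clock

/-- The piecewise linear function that is `0` up to `k`, `1` from `k + 1` on, and linear in
between. -/
noncomputable def ramp (k : ℕ) (x : ℝ) : ℝ := max 0 (min 1 (x - k))

lemma continuous_ramp (k : ℕ) : Continuous (ramp k) := by
  unfold ramp
  fun_prop

lemma monotone_ramp (k : ℕ) : Monotone (ramp k) := fun x y h => by
  unfold ramp
  gcongr

lemma ramp_nonneg (k : ℕ) (x : ℝ) : 0 ≤ ramp k x := le_max_left _ _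

lemma ramp_le_one (k : ℕ) (x : ℝ) : ramp k x ≤ 1 := max_le zero_le_one (min_le_left _ _)

lemma ramp_eq_zero {k : ℕ} {x : ℝ} (h : x ≤ k) : ramp k x = 0 :=
  max_eq_left ((min_le_right _ _).trans (sub_nonpos.2 h))

lemma ramp_eq_one {k : ℕ} {x : ℝ} (h : (k : ℝ) + 1 ≤ x) : ramp k x = 1 := by
  rw [ramp, min_eq_left (by linarith), max_eq_right zero_le_one]

/-- The piecewise linear clock that shows `T k` on the interval `[2k - 1, 2k]` and moves from `T k`
to `T (k + 1)` on the interval `[2k, 2k + 1]`, for `k ≤ m`, normalised to start at `0`. -/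
noncomputable def clock (m : ℕ) (T : ℕ → ℝ) (x : ℝ) : ℝ :=
  ∑ k ∈ Finset.range (m + 1), (T (k + 1) - T k) * ramp (2 * k) x

lemma continuous_clock (m : ℕ) (T : ℕ → ℝ) : Continuous (clock m T) :=
  continuous_finsetSum _ fun _ _ => continuous_const.mul (continuous_ramp _)

lemma monotone_clock (m : ℕ) {T : ℕ → ℝ} (hT : Monotone T) : Monotone (clock m T) :=
  fun _ _ h => Finset.sum_le_sum fun k _ =>
    mul_le_mul_of_nonneg_left (monotone_ramp _ h) (sub_nonneg.2 (hT k.le_succ))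

lemma clock_zero (m : ℕ) (T : ℕ → ℝ) : clock m T 0 = 0 :=
  Finset.sum_eq_zero fun k _ => by rw [ramp_eq_zero (by positivity), mul_zero]

lemma le_clock {m : ℕ} {T : ℕ → ℝ} (hT : Monotone T) (hT0 : T 0 = 0) {n : ℕ} (hn : n ≤ m) {x : ℝ}
    (hx : (2 * n + 1 : ℝ) ≤ x) : T (n + 1) ≤ clock m T x := by
  have hsum : ∑ k ∈ Finset.range (n + 1), (T (k + 1) - T k) = T (n + 1) := by
    rw [Finset.sum_range_sub, hT0, sub_zero]
  rw [← hsum]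
  refine (Finset.sum_le_sum fun k hk => ?_).trans (Finset.sum_le_sum_of_subset_of_nonneg
    (Finset.range_mono (Nat.succ_le_succ hn)) fun k _ _ =>
      mul_nonneg (sub_nonneg.2 (hT k.le_succ)) (ramp_nonneg _ _))
  have hk' : (k : ℝ) ≤ n := by exact_mod_cast Nat.lt_succ_iff.1 (Finset.mem_range.1 hk)
  rw [ramp_eq_one (by push_cast; linarith), mul_one]

lemma clock_le {m : ℕ} {T : ℕ → ℝ} (hT : Monotone T) (hT0 : T 0 = 0) {n : ℕ} (hn : n ≤ m) {x : ℝ}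
    (hx : x ≤ (2 * n + 2 : ℝ)) : clock m T x ≤ T (n + 1) := by
  have hsum : ∑ k ∈ Finset.range (n + 1), (T (k + 1) - T k) = T (n + 1) := by
    rw [Finset.sum_range_sub, hT0, sub_zero]
  rw [← hsum, clock, ← Finset.sum_subset (Finset.range_mono (Nat.succ_le_succ hn))]
  · exact Finset.sum_le_sum fun k _ =>
      mul_le_of_le_one_right (sub_nonneg.2 (hT k.le_succ)) (ramp_le_one _ _)
  · intro k _ hk
    have hk' : (n : ℝ) + 1 ≤ k := by exact_mod_cast not_lt.1 fun h => hk (Finset.mem_range.2 h)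
    rw [ramp_eq_zero (by push_cast; linarith), mul_zero]

lemma abs_clock_sub_le (m : ℕ) {T T' : ℕ → ℝ} {δ : ℝ} (h : ∀ k, |T' k - T k| ≤ δ) (x : ℝ) :
    |clock m T' x - clock m T x| ≤ (m + 1) * (2 * δ) := by
  rw [clock, clock, ← Finset.sum_sub_distrib]
  refine (Finset.abs_sum_le_sum_abs _ _).trans ?_
  refine (Finset.sum_le_card_nsmul _ _ (2 * δ) fun k _ => ?_).trans (by simp)
  rw [← sub_mul, abs_mul, abs_of_nonneg (ramp_nonneg _ _)]
  refine (mul_le_of_le_one_right (abs_nonneg _) (ramp_le_one _ _)).trans ?_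
  have h1 := abs_le.1 (h k)
  have h2 := abs_le.1 (h (k + 1))
  exact abs_le.2 ⟨by linarith, by linarith⟩

/-- The times `0 ≤ τ 0 ≤ ⋯ ≤ τ (m - 1) ≤ 1` framed by `0` and `1`. -/
noncomputable def framed {m : ℕ} (τ : Fin m → I) : ℕ → ℝ
  | 0 => 0
  | k + 1 => if h : k < m then (τ ⟨k, h⟩ : ℝ) else 1

lemma monotone_framed {m : ℕ} {τ : Fin m → I} (hτ : Monotone τ) : Monotone (framed τ) := by
  refine monotone_nat_of_le_succ fun k => ?_
  obtain _ | k := k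
  · simp only [framed]
    split_ifs
    exacts [(τ _).2.1, zero_le_one]
  · simp only [framed]
    split_ifs with h1 h2
    · exact hτ (Nat.le_succ k)
    · exact (τ _).2.2
    · omega
    · rfl

lemma exists_clock {m : ℕ} {τ : Fin m → I} (hτ : Monotone τ) :
    ∃ r : C(I, I), (∀ s, (r s : ℝ) = clock m (framed τ) ((2 * m + 1) * s)) ∧ Monotone r ∧
      r 0 = 0 ∧ r 1 = 1 ∧ (∀ i s, r s < τ i → ramp (2 * i + 1) ((2 * m + 1) * s) = 0) ∧
      ∀ i s, τ i < r s → ramp (2 * i + 1) ((2 * m + 1) * s) = 1 := by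
  have hT := monotone_framed hτ
  have hpos : (0 : ℝ) < 2 * m + 1 := by positivity
  have hTlast : framed τ (m + 1) = 1 := by simp [framed]
  have hTi : ∀ i : Fin m, framed τ (i + 1) = τ i := fun i => by simp [framed]
  have hmem : ∀ s : I, clock m (framed τ) ((2 * m + 1) * s) ∈ Icc (0 : ℝ) 1 := by
    intro s
    constructor
    · rw [← clock_zero m (framed τ)]
      exact monotone_clock m hT (mul_nonneg hpos.le s.2.1)
    · rw [← hTlast]
      exact clock_le hT rfl le_rfl (by nlinarith [s.2.2])
  refine ⟨⟨fun s => ⟨clock m (framed τ) ((2 * m + 1) * s), hmem s⟩,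
    ((continuous_clock _ _).comp (by fun_prop)).subtype_mk _⟩, fun s => rfl, ?_, ?_, ?_, ?_, ?_⟩
  · intro s s' h
    exact monotone_clock m hT (mul_le_mul_of_nonneg_left h hpos.le)
  · refine Subtype.ext ?_
    change clock m (framed τ) ((2 * m + 1) * ((0 : I) : ℝ)) = 0
    rw [Set.Icc.coe_zero, mul_zero, clock_zero]
  · refine Subtype.ext (le_antisymm (hmem 1).2 ?_)
    change 1 ≤ clock m (framed τ) ((2 * m + 1) * ((1 : I) : ℝ))
    rw [Set.Icc.coe_one, mul_one]
    exact hTlast.symm.le.trans (le_clock hT rfl le_rfl le_rfl)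
  · intro i s h
    refine ramp_eq_zero ?_
    by_contra! hlt
    have := le_clock hT rfl i.2.le (x := (2 * m + 1) * (s : ℝ)) (by push_cast at hlt; linarith)
    rw [hTi] at this
    exact absurd h (not_lt.2 this)
  · intro i s h
    refine ramp_eq_one ?_
    by_contra! hlt
    have := clock_le hT rfl i.2.le (x := (2 * m + 1) * (s : ℝ)) (by push_cast at hlt; linarith)
    rw [hTi] at this
    exact absurd h (not_lt.2 this)

end Clock

/-! ### The distance between step functions with the same number of jumps -/

section Distance

variable {d : ℕ} {ι : Type*} [Fintype ι]

/-- If the jumps of two step functions can be matched so that their order is respected, one set of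
switches serves both clocks, so the two parametric representations differ only by the
differences of the jump times and of the jump vectors. -/
lemma weakM1Dist_stepFun_le (N : Seminorm ℝ (Fin d → ℝ)) {τ τ' : ι → I} {c c' : ι → Fin d → ℝ}
    (hτ0 : ∀ i, 0 < τ i) (hτ1 : ∀ i, τ i < 1) (hτ0' : ∀ i, 0 < τ' i) (hτ1' : ∀ i, τ' i < 1)
    (hsign : ∀ i k j, τ i = τ k → 0 < c i j → 0 ≤ c k j)
    (hsign' : ∀ i k j, τ' i = τ' k → 0 < c' i j → 0 ≤ c' k j)
    (horder : ∀ i k, τ i < τ k → τ' i < τ' k) {δ : ℝ} (hδ : 0 ≤ δ)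
    (hτδ : ∀ i, |(τ' i : ℝ) - τ i| ≤ δ) :
    weakM1Dist N (stepFun τ' c') (stepFun τ c) ≤
      max (ENNReal.ofReal ((Fintype.card ι + 1) * (2 * δ)))
        (ENNReal.ofReal (∑ i, N (c' i - c i))) := by
  classical
  set m := Fintype.card ι
  let f : Fin m ≃ ι :=
    (Tuple.sort (τ' ∘ (Fintype.equivFin ι).symm)).trans (Fintype.equivFin ι).symm
  have hmono' : Monotone (τ' ∘ f) := Tuple.monotone_sort (τ' ∘ (Fintype.equivFin ι).symm)
  have hmono : Monotone (τ ∘ f) := fun i k hik => by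
    by_contra! hlt
    exact absurd (horder _ _ hlt) (not_lt.2 (hmono' hik))
  obtain ⟨r, hrc, hr, hr0, hr1, hrlt, hrgt⟩ := exists_clock hmono
  obtain ⟨r', hrc', hr', hr0', hr1', hrlt', hrgt'⟩ := exists_clock hmono'
  let ρ : ι → I → ℝ := fun i s => ramp (2 * (f.symm i) + 1) ((2 * m + 1) * s)
  have hρ : ∀ i, Monotone (ρ i) := fun i s s' h =>
    monotone_ramp _ (mul_le_mul_of_nonneg_left h (by positivity))
  have hρ01 : ∀ i s, ρ i s ∈ Icc (0 : ℝ) 1 := fun i s => ⟨ramp_nonneg _ _, ramp_le_one _ _⟩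
  have hρc : ∀ i, Continuous (ρ i) := fun i => (continuous_ramp _).comp (by fun_prop)
  have hlt : ∀ i s, r s < τ i → ρ i s = 0 := fun i s h => hrlt (f.symm i) s (by simpa using h)
  have hgt : ∀ i s, τ i < r s → ρ i s = 1 := fun i s h => hrgt (f.symm i) s (by simpa using h)
  have hlt' : ∀ i s, r' s < τ' i → ρ i s = 0 := fun i s h =>
    hrlt' (f.symm i) s (by simpa using h)
  have hgt' : ∀ i s, τ' i < r' s → ρ i s = 1 := fun i s h =>
    hrgt' (f.symm i) s (by simpa using h)
  let w : C(I, Fin d → ℝ) := ⟨fun s => ∑ i, ρ i s • c i, by fun_prop⟩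
  let w' : C(I, Fin d → ℝ) := ⟨fun s => ∑ i, ρ i s • c' i, by fun_prop⟩
  have hW : IsWeakParam (stepFun τ c) r w :=
    isWeakParam_stepFun hτ0 hτ1 hsign (fun s => rfl) hr hr0 hr1 hρ hρ01 hlt hgt
  have hW' : IsWeakParam (stepFun τ' c') r' w' :=
    isWeakParam_stepFun hτ0' hτ1' hsign' (fun s => rfl) hr' hr0' hr1' hρ hρ01 hlt' hgt'
  refine (iInf_le_of_le r' <| iInf_le_of_le w' <| iInf_le_of_le hW' <| iInf_le_of_le r <|
    iInf_le_of_le w <| iInf_le_of_le hW le_rfl).trans (max_le_max ?_ ?_)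
  · refine iSup_le fun s => ENNReal.ofReal_le_ofReal ?_
    rw [hrc, hrc']
    refine abs_clock_sub_le m (fun k => ?_) _
    obtain _ | k := k
    · simpa [framed] using hδ
    · simp only [framed]
      split_ifs
      · exact hτδ _
      · simpa using hδ
  · refine iSup_le fun s => ENNReal.ofReal_le_ofReal ?_
    have hdiff : w' s - w s = ∑ i, ρ i s • (c' i - c i) := by
      change ∑ i, ρ i s • c' i - ∑ i, ρ i s • c i = _
      simp only [smul_sub, Finset.sum_sub_distrib]
    rw [hdiff]
    refine (Finset.le_sum_of_subadditive N (map_zero N).le (map_add_le_add N) _ _).trans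
      (Finset.sum_le_sum fun i _ => ?_)
    rw [map_smul_eq_mul, Real.norm_of_nonneg (hρ01 i s).1]
    exact mul_le_of_le_one_left (apply_nonneg N _) (hρ01 i s).2

end Distance

/-! ### Extended reals and the extended norm -/

section EReal

lemma ofReal_lt_abs_iff {u : ℝ} (hu : 0 < u) (y : EReal) :
    ENNReal.ofReal u < y.abs ↔ (u : EReal) < y ∨ y < ((-u : ℝ) : EReal) := by
  induction y with
  | bot => simpa using EReal.bot_lt_coe (-u)
  | top => simp
  | coe y =>
    rw [EReal.abs_def, ENNReal.ofReal_lt_ofReal_iff_of_nonneg hu.le, EReal.coe_lt_coe_iff,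
      EReal.coe_lt_coe_iff, lt_abs]
    exact or_congr_right ⟨fun h => by linarith, fun h => by linarith⟩

lemma ofReal_le_abs_iff (u : ℝ) (y : EReal) :
    ENNReal.ofReal u ≤ y.abs ↔ (u : EReal) ≤ y ∨ y ≤ ((-u : ℝ) : EReal) := by
  induction y with
  | bot => simp
  | top => simp
  | coe y =>
    rw [EReal.abs_def, ENNReal.ofReal_le_ofReal_iff (abs_nonneg y), EReal.coe_le_coe_iff,
      EReal.coe_le_coe_iff, le_abs]
    exact or_congr_right ⟨fun h => by linarith, fun h => by linarith⟩

lemma isOpen_ofReal_lt_abs {u : ℝ} (hu : 0 < u) :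
    IsOpen {y : EReal | ENNReal.ofReal u < y.abs} := by
  simp only [ofReal_lt_abs_iff hu]
  exact isOpen_Ioi.union isOpen_Iio

lemma isClosed_ofReal_le_abs (u : ℝ) :
    IsClosed {y : EReal | ENNReal.ofReal u ≤ y.abs} := by
  simp only [ofReal_le_abs_iff u]
  exact isClosed_Ici.union isClosed_Iic

lemma abs_lt_top_iff_mem (y : EReal) : y.abs < ⊤ ↔ y ∈ ({⊥, ⊤}ᶜ : Set EReal) := by
  induction y <;> simp [EReal.abs_def]

lemma isOpen_abs_lt_top : IsOpen {y : EReal | y.abs < ⊤} := by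
  simp only [abs_lt_top_iff_mem]
  exact (Set.toFinite _).isClosed.isOpen_compl

lemma continuousAt_toReal_of_abs {y : EReal} (hy : y.abs < ⊤) : ContinuousAt EReal.toReal y :=
  EReal.continuousOn_toReal.continuousAt
    ((Set.toFinite _).isClosed.isOpen_compl.mem_nhds ((abs_lt_top_iff_mem y).1 hy))

end EReal

section Norm

variable {d : ℕ} {N : Seminorm ℝ (Fin d → ℝ)}

lemma continuous_seminorm_fin (N : Seminorm ℝ (Fin d → ℝ)) : Continuous N := by
  have h := N.convexOn.continuousOn isOpen_univ
  rwa [← continuousOn_univ]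

lemma abs_le_extNorm (hN : ∀ x j, |x j| ≤ N x) (x : Fin d → EReal) (j : Fin d) :
    (x j).abs ≤ extNorm N x := by
  rw [extNorm]
  split_ifs with h
  · rw [← EReal.coe_toReal (x := x j) (fun h' => by simpa [h'] using h j)
      (fun h' => by simpa [h'] using h j), EReal.abs_def]
    exact ENNReal.ofReal_le_ofReal (hN (fun j => (x j).toReal) j)
  · exact le_top

lemma isOpen_lt_extNorm (hN : ∀ x j, |x j| ≤ N x) {v : ℝ} (hv : 0 < v) :
    IsOpen {x : Fin d → EReal | ENNReal.ofReal v < extNorm N x} := by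
  rw [isOpen_iff_mem_nhds]
  intro x hx
  by_cases h : ∀ j, (x j).abs < ⊤
  · have hfin : ∀ᶠ y : Fin d → EReal in 𝓝 x, ∀ j, (y j).abs < ⊤ :=
      eventually_all.2 fun j =>
        (continuous_apply j).continuousAt.eventually (isOpen_abs_lt_top.mem_nhds (h j))
    have hcont : ContinuousAt (fun y : Fin d → EReal => N fun j => (y j).toReal) x :=
      (continuous_seminorm_fin N).continuousAt.comp (continuousAt_pi.2 fun j =>
        ContinuousAt.comp (f := fun y : Fin d → EReal => y j) (continuousAt_toReal_of_abs (h j))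
          (continuous_apply j).continuousAt)
    have hxN : v < N fun j => (x j).toReal := by
      rw [mem_ofPred_eq, extNorm, if_pos h] at hx
      exact (ENNReal.ofReal_lt_ofReal_iff_of_nonneg hv.le).1 hx
    filter_upwards [hfin, hcont.eventually_const_lt hxN] with y hy hyN
    rw [extNorm, if_pos hy]
    exact (ENNReal.ofReal_lt_ofReal_iff_of_nonneg hv.le).2 hyN
  · push Not at h
    obtain ⟨j, hj⟩ := h
    have hxj : ENNReal.ofReal v < (x j).abs := ENNReal.ofReal_lt_top.trans_le hj
    filter_upwards [(continuous_apply j).continuousAt.eventually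
      ((isOpen_ofReal_lt_abs hv).mem_nhds hxj)] with y hy
    exact lt_of_lt_of_le hy (abs_le_extNorm hN y j)

lemma locallyCompactSpace_timeSpace (hN : ∀ x j, |x j| ≤ N x) {v : ℝ} (hv : 0 < v) :
    LocallyCompactSpace (TimeSpace N v) := by
  have : LocallyCompactSpace (Exceed N v) := (isOpen_lt_extNorm hN hv).locallyCompactSpace
  infer_instance

lemma secondCountableTopology_timeSpace (N : Seminorm ℝ (Fin d → ℝ)) (v : ℝ) :
    SecondCountableTopology (TimeSpace N v) := by
  have : SecondCountableTopology (Exceed N v) :=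
    TopologicalSpace.Subtype.secondCountableTopology {x | ENNReal.ofReal v < extNorm N x}
  infer_instance

/-- The points with a coordinate of modulus at least `u`, the only ones that matter for the
summation functional. -/
def largePoints (N : Seminorm ℝ (Fin d → ℝ)) (v u : ℝ) : Set (TimeSpace N v) :=
  {p | ∃ j, ENNReal.ofReal u ≤ (p.2.1 j).abs}

lemma isCompact_largePoints (hN : ∀ x j, |x j| ≤ N x) {v u : ℝ} (hv : 0 < v) (hvu : v < u) :
    IsCompact (largePoints N v u) := by
  have hu := hv.trans hvu
  let K : Set (I × (Fin d → EReal)) := {p | ∃ j, ENNReal.ofReal u ≤ (p.2 j).abs}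
  have hK : IsClosed K := by
    simp only [K, ofPred_exists]
    exact isClosed_iUnion_of_finite fun j =>
      (isClosed_ofReal_le_abs u).preimage (f := fun p : I × (Fin d → EReal) => p.2 j) (by fun_prop)
  have hemb : IsInducing (Prod.map id Subtype.val : TimeSpace N v → I × (Fin d → EReal)) :=
    IsInducing.id.prodMap IsInducing.subtypeVal
  refine hemb.isCompact_preimage' hK.isCompact ?_
  rintro ⟨t, x⟩ ⟨j, hj⟩
  refine ⟨(t, ⟨x, ?_⟩), rfl⟩
  exact ((ENNReal.ofReal_lt_ofReal_iff hu).2 hvu).trans_le (hj.trans (abs_le_extNorm hN x j))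

lemma continuous_coord (N : Seminorm ℝ (Fin d → ℝ)) (v : ℝ) (j : Fin d) :
    Continuous fun q : TimeSpace N v => q.2.1 j :=
  (continuous_apply j).comp (continuous_subtype_val.comp continuous_snd)

lemma mem_interior_largePoints {v u : ℝ} (hu : 0 < u) {p : TimeSpace N v} {j : Fin d}
    (hj : ENNReal.ofReal u < (p.2.1 j).abs) : p ∈ interior (largePoints N v u) := by
  rw [mem_interior_iff_mem_nhds]
  have hc := continuous_coord N v j
  filter_upwards [hc.continuousAt.eventually ((isOpen_ofReal_lt_abs hu).mem_nhds hj)] with q hq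
  exact ⟨j, le_of_lt hq⟩

end Norm

/-! ### Truncated jumps -/

section Truncate

/-- The contribution of a coordinate `y` to the summation functional: `y` itself when
`u < |y| < ∞`, and `0` otherwise. -/
noncomputable def truncate (u : ℝ) (y : EReal) : ℝ :=
  open Classical in if ExceedsFinite u y then y.toReal else 0

lemma truncate_pos {u : ℝ} (hu : 0 < u) {y : EReal} (h : 0 < truncate u y) : (u : EReal) < y := by
  rw [truncate] at h
  split_ifs at h with hy
  · refine ((ofReal_lt_abs_iff hu y).1 hy.1).resolve_right fun hlt => ?_
    exact absurd (EReal.toReal_nonpos (hlt.le.trans (by exact_mod_cast neg_nonpos.2 hu.le)))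
      (not_le.2 h)
  · exact absurd h (lt_irrefl 0)

lemma truncate_neg {u : ℝ} (hu : 0 < u) {y : EReal} (h : truncate u y < 0) :
    y < ((-u : ℝ) : EReal) := by
  rw [truncate] at h
  split_ifs at h with hy
  · refine ((ofReal_lt_abs_iff hu y).1 hy.1).resolve_left fun hlt => ?_
    exact absurd (EReal.toReal_nonneg (le_trans (by exact_mod_cast hu.le) hlt.le)) (not_le.2 h)
  · exact absurd h (lt_irrefl 0)

lemma truncate_of_lt {u : ℝ} {y : EReal} (h : y.abs < ENNReal.ofReal u) : truncate u y = 0 :=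
  if_neg fun hy => h.not_gt hy.1

lemma eventually_truncate_eq_zero {u : ℝ} {y : EReal} (h : y.abs < ENNReal.ofReal u) :
    ∀ᶠ z in 𝓝 y, truncate u z = 0 := by
  have ho : {z : EReal | ENNReal.ofReal u ≤ z.abs}ᶜ ∈ 𝓝 y :=
    (isClosed_ofReal_le_abs u).isOpen_compl.mem_nhds (not_le.2 h)
  filter_upwards [ho] with z hz
  exact truncate_of_lt (not_le.1 hz)

lemma continuousAt_truncate {u : ℝ} (hu : 0 < u) {y : EReal} (h : y.abs ≠ ENNReal.ofReal u)
    (h' : y.abs ≠ ⊤) : ContinuousAt (truncate u) y := by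
  rcases h.lt_or_gt with hlt | hgt
  · have := eventually_truncate_eq_zero hlt
    exact (continuousAt_const (y := (0 : ℝ))).congr (this.mono fun _ h => h.symm)
  · refine (continuousAt_toReal_of_abs h'.lt_top).congr ?_
    filter_upwards [(isOpen_ofReal_lt_abs hu).mem_nhds hgt,
      isOpen_abs_lt_top.mem_nhds h'.lt_top] with z hz hz'
    exact (if_pos ⟨hz, hz'⟩).symm

/-- Near a coordinate with `|y| ∉ {u, ∞}`, truncation creates no new signs. This includes the case
`truncate u y = 0`, in which `|y| < u`. -/
lemma eventually_truncate_pos_imp {u : ℝ} (hu : 0 < u) {y : EReal}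
    (h : y.abs ≠ ENNReal.ofReal u) (h' : y.abs ≠ ⊤) :
    ∀ᶠ z in 𝓝 y, (0 < truncate u z → 0 < truncate u y) ∧
      (truncate u z < 0 → truncate u y < 0) := by
  rcases h.lt_or_gt with hlt | hgt
  · filter_upwards [eventually_truncate_eq_zero hlt] with z hz
    simp [hz]
  · have hc := continuousAt_truncate hu h h'
    have hne : truncate u y ≠ 0 := by
      rw [truncate, if_pos ⟨hgt, h'.lt_top⟩]
      intro h0
      rw [EReal.toReal_eq_zero_iff] at h0
      rcases h0 with rfl | rfl | rfl <;> simp at hgt h'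
    rcases hne.lt_or_gt with hneg | hpos
    · filter_upwards [hc.eventually_lt_const hneg] with z hz
      exact ⟨fun h => absurd h hz.not_gt, fun _ => hneg⟩
    · filter_upwards [hc.eventually_const_lt hpos] with z hz
      exact ⟨fun _ => hpos, fun h => absurd h hz.not_gt⟩

end Truncate

/-! ### The summation functional as a step function -/

section Summation

variable {d : ℕ} {N : Seminorm ℝ (Fin d → ℝ)} {v u : ℝ}

/-- The jump that a point `q` contributes to the summation functional. -/
noncomputable def truncatedJump (u : ℝ) (q : TimeSpace N v) : Fin d → ℝ :=
  fun j => truncate u (q.2.1 j)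

lemma measurableSet_exceedsFinite (hu : 0 < u) (t : I) (j : Fin d) :
    MeasurableSet {p : TimeSpace N v | p.1 ≤ t ∧ ExceedsFinite u (p.2.1 j)} := by
  have hc := continuous_coord N v j
  have h1 : IsClosed {p : TimeSpace N v | p.1 ≤ t} := isClosed_le continuous_fst continuous_const
  exact h1.measurableSet.inter (((isOpen_ofReal_lt_abs hu).preimage hc).measurableSet.inter
    (isOpen_abs_lt_top.preimage hc).measurableSet)

lemma setOf_exceedsFinite_subset (t : I) (j : Fin d) :
    {p : TimeSpace N v | p.1 ≤ t ∧ ExceedsFinite u (p.2.1 j)} ⊆ largePoints N v u :=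
  fun _ hp => ⟨j, hp.2.1.le⟩

lemma finite_exceedsFinite (hN : ∀ x j, |x j| ≤ N x) (hv : 0 < v) (hvu : v < u)
    (η : RadonPointMeasure N v) {ι : Type*} {p : ι → TimeSpace N v}
    (hp : η.1 = Measure.sum fun i => Measure.dirac (p i)) (t : I) (j : Fin d) :
    {i | (p i).1 ≤ t ∧ ExceedsFinite u ((p i).2.1 j)}.Finite := by
  have := η.2.2
  exact (finite_preimage_of_isCompact hp (isCompact_largePoints hN hv hvu)).subset
    (preimage_mono (setOf_exceedsFinite_subset t j))

lemma summation_eq_finsum (hN : ∀ x j, |x j| ≤ N x) (hv : 0 < v) (hvu : v < u)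
    (η : RadonPointMeasure N v) {ι : Type*} {p : ι → TimeSpace N v}
    (hp : η.1 = Measure.sum fun i => Measure.dirac (p i)) (t : I) (j : Fin d) :
    summation u η t j =
      ∑ᶠ i ∈ {i | (p i).1 ≤ t ∧ ExceedsFinite u ((p i).2.1 j)}, ((p i).2.1 j).toReal := by
  have hfin := finite_exceedsFinite hN hv hvu η hp t j
  rw [finsum_mem_eq_finite_toFinset_sum _ hfin, summation, hp]
  exact setIntegral_sum_dirac p (measurableSet_exceedsFinite (hv.trans hvu) t j) hfin
    fun q => (q.2.1 j).toReal

lemma summation_eq_stepFun (hN : ∀ x j, |x j| ≤ N x) (hv : 0 < v) (hvu : v < u)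
    (η : RadonPointMeasure N v) {ι : Type*} {p : ι → TimeSpace N v}
    (hp : η.1 = Measure.sum fun i => Measure.dirac (p i))
    [Fintype {i // p i ∈ largePoints N v u}] :
    summation u η = stepFun (fun i : {i // p i ∈ largePoints N v u} => (p i).1)
      fun i => truncatedJump u (p i) := by
  classical
  ext t j
  have hfin := finite_exceedsFinite hN hv hvu η hp t j
  have := η.2.2
  have hfin' := finite_preimage_of_isCompact hp (isCompact_largePoints hN hv hvu)
  rw [summation_eq_finsum hN hv hvu η hp, finsum_mem_eq_finite_toFinset_sum _ hfin, stepFun,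
    Finset.sum_apply]
  have hsub : hfin.toFinset ⊆ hfin'.toFinset := Set.Finite.toFinset_subset_toFinset.2
    (preimage_mono (setOf_exceedsFinite_subset t j))
  have hcoe : ∑ i ∈ hfin'.toFinset,
      (if (p i).1 ≤ t then truncatedJump u (p i) else 0 : Fin d → ℝ) j =
      ∑ i : {i // p i ∈ largePoints N v u},
        (if (p i).1 ≤ t then truncatedJump u (p i) else 0 : Fin d → ℝ) j :=
    Finset.sum_subtype _ (fun i => by simp) _
  rw [← hcoe, ← Finset.sum_subset hsub]
  · refine Finset.sum_congr rfl fun i hi => ?_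
    have hi' := (Set.Finite.mem_toFinset hfin).1 hi
    rw [if_pos hi'.1]
    exact (if_pos hi'.2).symm
  · intro i _ hi
    have hi' : ¬((p i).1 ≤ t ∧ ExceedsFinite u ((p i).2.1 j)) := fun h =>
      hi ((Set.Finite.mem_toFinset hfin).2 h)
    split_ifs with ht
    · exact if_neg fun h => hi' ⟨ht, h⟩
    · rfl

lemma isCadlag_summation (hN : ∀ x j, |x j| ≤ N x) (hv : 0 < v) (hvu : v < u)
    (η : RadonPointMeasure N v) : IsCadlag (summation u η) := by
  obtain ⟨ι, _, p, hp⟩ := η.2.1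
  have := η.2.2
  have : Finite {i // p i ∈ largePoints N v u} :=
    finite_preimage_of_isCompact hp (isCompact_largePoints hN hv hvu)
  have := Fintype.ofFinite {i // p i ∈ largePoints N v u}
  rw [summation_eq_stepFun hN hv hvu η hp]
  exact isCadlag_stepFun _ _

end Summation

/-! ### Continuity -/

section Continuity

variable {d : ℕ} {N : Seminorm ℝ (Fin d → ℝ)} {v u : ℝ}

lemma tendsto_integral_of_vague (η : RadonPointMeasure N v)
    (f : CompactlySupportedContinuousMap (TimeSpace N v) ℝ≥0) :
    Tendsto (fun ξ : RadonPointMeasure N v => ∫ q, (f q : ℝ) ∂ξ.1) (𝓝 η)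
      (𝓝 (∫ q, (f q : ℝ) ∂η.1)) := by
  have h : Continuous fun (ξ : RadonPointMeasure N v)
      (f : CompactlySupportedContinuousMap (TimeSpace N v) ℝ≥0) => ∫ q, (f q : ℝ) ∂ξ.1 :=
    continuous_induced_dom
  exact ((continuous_apply f).comp h).tendsto η

/-- Convergence of the summation functional in `d_w`: the matched points give two step functions
to which `weakM1Dist_stepFun_le` applies. -/
theorem tendsto_weakM1Dist_summation (hN : ∀ x j, |x j| ≤ N x) (hv : 0 < v) (hvu : v < u)
    {η : RadonPointMeasure N v} (hη : η ∈ Lambda₁ N v u) (hsgn : NoOppositeSigns u η) :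
    Tendsto (fun ξ : RadonPointMeasure N v => weakM1Dist N (summation u ξ) (summation u η))
      (𝓝 η) (𝓝 0) := by
  have hu := hv.trans hvu
  have := locallyCompactSpace_timeSpace hN hv
  have := secondCountableTopology_timeSpace N v
  have := η.2.2
  have hC := isCompact_largePoints hN hv hvu
  obtain ⟨ι, _, p, hp⟩ := η.2.1
  have : Finite {i // p i ∈ largePoints N v u} := finite_preimage_of_isCompact hp hC
  have := Fintype.ofFinite {i // p i ∈ largePoints N v u}
  have hcoord : ∀ i j, ((p i).2.1 j).abs ≠ ENNReal.ofReal u ∧ ((p i).2.1 j).abs ≠ ⊤ := fun i j =>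
    not_or.1 fun h => notMem_of_sum_dirac_eq_zero hp hη.2 i ⟨j, h⟩
  have hlarge : ∀ i, p i ∈ largePoints N v u → ∃ j, ENNReal.ofReal u < ((p i).2.1 j).abs := by
    rintro i ⟨j, hj⟩
    exact ⟨j, lt_of_le_of_ne hj (hcoord i j).1.symm⟩
  have htime : ∀ i : {i // p i ∈ largePoints N v u}, 0 < (p i).1 ∧ (p i).1 < 1 := by
    rintro ⟨i, hi⟩
    obtain ⟨j, hj⟩ := hlarge i hi
    have hn : ¬((p i).1 = 0 ∨ (p i).1 = 1) := fun h =>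
      notMem_of_sum_dirac_eq_zero hp hη.1 i ⟨h, hj.trans_le (abs_le_extNorm hN _ j)⟩
    rw [not_or] at hn
    exact ⟨unitInterval.pos_iff_ne_zero.2 hn.1, unitInterval.lt_one_iff_ne_one.2 hn.2⟩
  have hsign : ∀ i k j, (p i).1 = (p k).1 →
      0 < truncatedJump u (p i) j → 0 ≤ truncatedJump u (p k) j := by
    intro i k j hik hpos
    by_contra! hneg
    rcases hsgn (p i).1 j with h | h
    · exact notMem_of_sum_dirac_eq_zero hp h i ⟨rfl, truncate_pos hu hpos⟩
    · exact notMem_of_sum_dirac_eq_zero hp h k ⟨hik.symm, truncate_neg hu hneg⟩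
  rw [ENNReal.tendsto_nhds_zero]
  intro ε hε
  rcases eq_or_ne ε ⊤ with rfl | hεtop
  · exact Eventually.of_forall fun _ => le_top
  have hε' : 0 < ε.toReal := ENNReal.toReal_pos hε.ne' hεtop
  set m := Fintype.card {i // p i ∈ largePoints N v u}
  -- Chosen so that the bound `(m + 1) * (2 * δ)` on the distance of the clocks equals `ε`.
  set δ := ε.toReal / (2 * (m + 1)) with hδ
  have hδ0 : 0 < δ := by positivity
  -- The conditions on the matched points are all open, hence hold near the points of `η`.
  have hev : ∀ᶠ z : {i // p i ∈ largePoints N v u} → TimeSpace N v in 𝓝 (fun i => p i),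
      (∀ i, 0 < (z i).1) ∧ (∀ i, (z i).1 < 1) ∧
      (∀ i k : {i // p i ∈ largePoints N v u}, (p i).1 < (p k).1 → (z i).1 < (z k).1) ∧
      (∀ i, |((z i).1 : ℝ) - (p i).1| < δ) ∧
      (∀ i j, (0 < truncatedJump u (z i) j → 0 < truncatedJump u (p i) j) ∧
        (truncatedJump u (z i) j < 0 → truncatedJump u (p i) j < 0)) ∧
      ∑ i, N (truncatedJump u (z i) - truncatedJump u (p i)) < ε.toReal := by
    have hz : ∀ i : {i // p i ∈ largePoints N v u},
        Continuous fun z : {i // p i ∈ largePoints N v u} → TimeSpace N v => (z i).1 :=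
      fun i => continuous_fst.comp (continuous_apply i)
    have hzc : ∀ (i : {i // p i ∈ largePoints N v u}) (j : Fin d),
        Continuous fun z : {i // p i ∈ largePoints N v u} → TimeSpace N v => (z i).2.1 j :=
      fun i j => (continuous_coord N v j).comp (continuous_apply i)
    refine eventually_all.2 (fun i => ?_) |>.and <| eventually_all.2 (fun i => ?_) |>.and <|
      eventually_all.2 (fun i => eventually_all.2 fun k => ?_) |>.and <|
      eventually_all.2 (fun i => ?_) |>.and <|
      eventually_all.2 (fun i => eventually_all.2 fun j => ?_) |>.and ?_
    · exact (hz i).continuousAt.eventually_const_lt (htime i).1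
    · exact (hz i).continuousAt.eventually_lt_const (htime i).2
    · by_cases h : (p i).1 < (p k).1
      · filter_upwards [(hz i).continuousAt.eventually_lt (hz k).continuousAt h] with z hzz _
        exact hzz
      · exact Eventually.of_forall fun z h' => absurd h' h
    · have hc : Continuous fun z : {i // p i ∈ largePoints N v u} → TimeSpace N v =>
          |((z i).1 : ℝ) - (p i).1| :=
        ((continuous_subtype_val.comp (hz i)).sub continuous_const).abs
      exact hc.continuousAt.eventually_lt_const (by simpa using hδ0)
    · exact (hzc i j).continuousAt.eventually
        (eventually_truncate_pos_imp hu (hcoord i j).1 (hcoord i j).2)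
    · have hc : ContinuousAt (fun z : {i // p i ∈ largePoints N v u} → TimeSpace N v =>
          ∑ i, N (truncatedJump u (z i) - truncatedJump u (p i))) (fun i => p i) := by
        refine tendsto_finsetSum _ fun i _ => ?_
        refine (continuous_seminorm_fin N).continuousAt.tendsto.comp ?_
        refine Tendsto.sub (tendsto_pi_nhds.2 fun j => ?_) tendsto_const_nhds
        exact (continuousAt_truncate hu (hcoord i j).1 (hcoord i j).2).tendsto.comp
          (hzc i j).continuousAt
      exact hc.eventually_lt_const (by simpa using hε')
  have hmatch := eventually_exists_matching (F := fun ξ : RadonPointMeasure N v => ξ.1)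
    (l := 𝓝 η) (fun ξ => ξ.2.2) (tendsto_integral_of_vague η) hp hC
    (fun i hi => by
      obtain ⟨j, hj⟩ := hlarge i hi
      exact mem_interior_largePoints hu hj) hev
  filter_upwards [hmatch] with ξ hξ
  obtain ⟨κ, _, q, hq⟩ := ξ.2.1
  obtain ⟨e, h0, h1, hord, hclose, hsg, hsum⟩ := hξ κ q hq
  have := Fintype.ofEquiv _ e
  have hξstep : summation u ξ = stepFun (fun i => (q (e i)).1)
      fun i => truncatedJump u (q (e i)) := by
    rw [summation_eq_stepFun hN hv hvu ξ hq]
    ext1 t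
    exact (Equiv.sum_comp e fun k : {k // q k ∈ largePoints N v u} =>
      if (q k).1 ≤ t then truncatedJump u (q k) else 0).symm
  have hsign' : ∀ i k j, (q (e i)).1 = (q (e k)).1 →
      0 < truncatedJump u (q (e i)) j → 0 ≤ truncatedJump u (q (e k)) j := by
    intro i k j hik hpos
    by_contra! hneg
    -- Equal times for `ξ` force equal times for `η`, since the order of the times is kept.
    have heq : (p i).1 = (p k).1 := le_antisymm
      (not_lt.1 fun h => (hord k i h).ne' hik) (not_lt.1 fun h => (hord i k h).ne hik)
    exact absurd (hsign i k j heq ((hsg i j).1 hpos)) (not_le.2 ((hsg k j).2 hneg))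
  rw [hξstep, summation_eq_stepFun hN hv hvu η hp]
  refine (weakM1Dist_stepFun_le N (fun i => (htime i).1) (fun i => (htime i).2) h0 h1
    (fun i k => hsign i k) hsign' hord hδ0.le fun i => (hclose i).le).trans (max_le ?_ ?_)
  · refine ENNReal.ofReal_le_of_le_toReal (le_of_eq ?_)
    rw [hδ]
    field_simp
    rfl
  · exact ENNReal.ofReal_le_of_le_toReal hsum.le

lemma continuousAt_of_tendsto_weakM1Dist {Y : Type*} [TopologicalSpace Y]
    {f : Y → SkorohodSpace N} {y : Y}
    (h : Tendsto (fun z => weakM1Dist N (f z).toFun (f y).toFun) (𝓝 y) (𝓝 0)) :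
    ContinuousAt f y := by
  refine tendsto_nhds.2 fun U hU hy => ?_
  obtain ⟨ε, hε, hball⟩ := hU (f y) hy
  filter_upwards [h.eventually_lt_const hε] with z hz
  exact hball _ hz

end Continuity

theorem lemma3p2 {d : ℕ} (N : Seminorm ℝ (Fin d → ℝ)) (hN : ∀ x j, |x j| ≤ N x)
    {v u : ℝ} (hv : 0 < v) (hvu : v < u) :
    (∀ (η : RadonPointMeasure N v) (ι : Type) [Countable ι] (p : ι → TimeSpace N v),
      η.1 = Measure.sum (fun i => Measure.dirac (p i)) →
      ∀ (t : unitInterval) (j : Fin d),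
        {i | (p i).1 ≤ t ∧ ExceedsFinite u ((p i).2.1 j)}.Finite ∧
        summation u η t j =
          ∑ᶠ i ∈ {i | (p i).1 ≤ t ∧ ExceedsFinite u ((p i).2.1 j)}, ((p i).2.1 j).toReal) ∧
    ∃ hD : ∀ η : RadonPointMeasure N v, IsCadlag (summation u η),
      ∀ η ∈ Lambda₁ N v u ∩ Lambda₂ N v, NoOppositeSigns u η →
        ContinuousAt
          (fun ξ : RadonPointMeasure N v => (⟨summation u ξ, hD ξ⟩ : SkorohodSpace N)) η ∧
        Tendsto (fun ξ : RadonPointMeasure N v => weakM1Dist N (summation u ξ) (summation u η))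
          (𝓝 η) (𝓝 0) :=
  ⟨fun η _ _ _ hp t j => ⟨finite_exceedsFinite hN hv hvu η hp t j,
      summation_eq_finsum hN hv hvu η hp t j⟩,
    isCadlag_summation hN hv hvu, fun _ hη hsgn =>
      ⟨continuousAt_of_tendsto_weakM1Dist (tendsto_weakM1Dist_summation hN hv hvu hη.1 hsgn),
        tendsto_weakM1Dist_summation hN hv hvu hη.1 hsgn⟩⟩
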